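/- Let $p\in(0,1)$ and let $\varepsilon_p$ be a random variable taking the value $1$ with probability $p$ and the value $0$ with probability $1-p$. Let $X,Y$ be independent identically distributed random variables that are almost surely positive, with the pair $(X,Y)$ independent of $\varepsilon_p$ (so that $X,Y,\varepsilon_p$ are mutually independent), and let $a,b>0$ be constants. Consider the linear forms with random coefficients $$L_1=(1-p)aX+\varepsilon_p aY,\qquad L_2=pbX+(1-\varepsilon_p)bY.$$ Then $L_1$ and $L_2$ are independent if and only if $X$ and $Y$ are exponentially distributed, that is, there is $r>0$ such that $X$ and $Y$ both have the density $r e^{-rx}$ on $x>0$ (and $0$ elsewhere). -/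

import Mathlib

open MeasureTheory ProbabilityTheory

/-! Write `φ s = E exp (-s X)`. Conditioning on `ε`, the joint Laplace transform of the two forms at
`(s/a, t/b)` is `φ (q s + p t) (p φ s + q φ t)` with `q = 1 - p`, so independence means that this
function factorizes as `f s * g t`.

For `φ s = r / (r + s)` the average `p φ s + q φ t` equals `φ s φ t / φ (q s + p t)`, and the
product collapses to `φ s φ t`. Conversely, a product `F = f g` satisfies `F F_st = F_s F_t`. On the
diagonal this reads `φ φ'' = 2 φ'^2`, that is `(1/φ)'' = 0`. Hence `1/φ` is affine, and `φ(0+) = 1`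
together with `X > 0` gives `1/φ = 1 + β s` with `β > 0`, an exponential law by uniqueness of
Laplace transforms. -/

/-! ### Transforms of nonnegative variables on the left half-plane -/

lemma continuousOn_complexMGF_of_nonneg {Ω : Type*} [MeasurableSpace Ω] {μ : Measure Ω}
    [IsFiniteMeasure μ] {X : Ω → ℝ} (hX : AEMeasurable X μ) (h0 : ∀ᵐ ω ∂μ, 0 ≤ X ω) :
    ContinuousOn (complexMGF X μ) {z | z.re ≤ 0} := by
  refine continuousOn_of_dominated (bound := fun _ => 1) (fun z _ => by fun_prop) ?_
    (integrable_const _) (.of_forall fun ω => by fun_prop)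
  intro z hz
  filter_upwards [h0] with ω hω
  simpa [Complex.norm_exp] using mul_nonpos_of_nonpos_of_nonneg hz hω

lemma Iic_subset_integrableExpSet_of_nonneg {Ω : Type*} [MeasurableSpace Ω] {μ : Measure Ω}
    [IsFiniteMeasure μ] {X : Ω → ℝ} (hX : AEMeasurable X μ) (h0 : ∀ᵐ ω ∂μ, 0 ≤ X ω) :
    Set.Iic 0 ⊆ integrableExpSet X μ := by
  intro t ht
  refine Integrable.of_bound (by fun_prop) 1 ?_
  filter_upwards [h0] with ω hω
  simpa using mul_nonpos_of_nonpos_of_nonneg ht hω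

lemma Iio_subset_interior_integrableExpSet_of_nonneg {Ω : Type*} [MeasurableSpace Ω]
    {μ : Measure Ω} [IsFiniteMeasure μ] {X : Ω → ℝ} (hX : AEMeasurable X μ)
    (h0 : ∀ᵐ ω ∂μ, 0 ≤ X ω) : Set.Iio 0 ⊆ interior (integrableExpSet X μ) := by
  rw [← interior_Iic]
  exact interior_mono (Iic_subset_integrableExpSet_of_nonneg hX h0)

/-- Finite measures carried by the half-line `[0, ∞)` are determined by their Laplace
transforms. -/
theorem ext_of_mgf_eqOn_Iio {μ ν : Measure ℝ} [IsFiniteMeasure μ] [IsFiniteMeasure ν]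
    (hμ : ∀ᵐ x ∂μ, 0 ≤ x) (hν : ∀ᵐ x ∂ν, 0 ≤ x)
    (h : Set.EqOn (mgf id μ) (mgf id ν) (Set.Iio 0)) : μ = ν := by
  have hopen : Set.EqOn (complexMGF id μ) (complexMGF id ν) {z | z.re < 0} := by
    refine AnalyticOnNhd.eqOn_of_preconnected_of_frequently_eq (z₀ := ((-1 : ℝ) : ℂ))
      (analyticOnNhd_complexMGF.mono fun z hz =>
        Iio_subset_interior_integrableExpSet_of_nonneg aemeasurable_id hμ hz)
      (analyticOnNhd_complexMGF.mono fun z hz =>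
        Iio_subset_interior_integrableExpSet_of_nonneg aemeasurable_id hν hz)
      ((convex_Iio (0 : ℝ)).linear_preimage Complex.reLm).isPreconnected (by simp) ?_
    -- The negative reals accumulate at `-1` inside the open half-plane, which is enough for the
    -- identity theorem.
    have hreal : ∃ᶠ (x : ℝ) in nhdsWithin (-1) {-1}ᶜ,
        complexMGF id μ x = complexMGF id ν x := by
      refine Filter.Eventually.frequently ?_
      filter_upwards [nhdsWithin_le_nhds (Iio_mem_nhds (show (-1 : ℝ) < 0 by norm_num))] with x hx
      rw [complexMGF_ofReal, complexMGF_ofReal, h hx]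
    refine Filter.Tendsto.frequently ?_ hreal
    refine tendsto_nhdsWithin_iff.2 ⟨?_, ?_⟩
    · exact (Complex.continuous_ofReal.tendsto _).mono_left nhdsWithin_le_nhds
    · filter_upwards [self_mem_nhdsWithin] with x hx
      exact fun hx' => hx (Complex.ofReal_injective hx')
  -- Continuity carries equality to the imaginary axis, where the transforms are characteristic
  -- functions.
  have hclosed : Set.EqOn (complexMGF id μ) (complexMGF id ν) {z | z.re ≤ 0} :=
    hopen.of_subset_closure (continuousOn_complexMGF_of_nonneg aemeasurable_id hμ)
      (continuousOn_complexMGF_of_nonneg aemeasurable_id hν) (fun z (hz : z.re < 0) => hz.le)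
      (Complex.closure_setOfPred_re_lt 0).ge
  refine Measure.ext_of_charFun (funext fun t => ?_)
  rw [← complexMGF_id_mul_I, ← complexMGF_id_mul_I]
  exact hclosed (by simp)

/-! ### Transform of the exponential law -/

lemma ae_nonneg_expMeasure (r : ℝ) : ∀ᵐ x ∂(expMeasure r), 0 ≤ x := by
  rw [ae_iff]
  simp only [not_le, expMeasure, gammaMeasure]
  change volume.withDensity (gammaPDF 1 r) (Set.Iio 0) = 0
  rw [withDensity_apply _ measurableSet_Iio]
  exact setLIntegral_eq_zero measurableSet_Iio fun x hx => gammaPDF_of_neg hx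

lemma complexMGF_id_expMeasure {r : ℝ} (hr : 0 < r) {z : ℂ} (hz : z.re < r) :
    complexMGF id (expMeasure r) z = r / (r - z) := by
  have hm : Measurable (exponentialPDF r) := (measurable_exponentialPDFReal r).ennreal_ofReal
  have : expMeasure r = volume.withDensity (exponentialPDF r) := rfl
  rw [complexMGF, this, integral_withDensity_eq_integral_toReal_smul hm
    (.of_forall fun x => by simp [exponentialPDF])]
  have hint : (fun x : ℝ => (exponentialPDF r x).toReal • Complex.exp (z * (id x : ℝ))) =
      (Set.Ici (0 : ℝ)).indicator (fun x : ℝ => (r : ℂ) * Complex.exp ((z - r) * x)) := by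
    ext x
    by_cases hx : 0 ≤ x
    · rw [Set.indicator_of_mem (Set.mem_Ici.2 hx), exponentialPDF_of_nonneg hx,
        ENNReal.toReal_ofReal (by positivity), Complex.real_smul]
      push_cast
      rw [mul_assoc, ← Complex.exp_add, id]
      ring_nf
    · rw [Set.indicator_of_notMem (by simpa using hx), exponentialPDF_of_neg (not_le.1 hx)]
      simp
  have hre : (z - r).re < 0 := by simpa using hz
  have hne : z - r ≠ 0 := fun h => by simp [h] at hre
  have hne' : (r : ℂ) - z ≠ 0 := fun h => hne (by rw [← neg_sub, h, neg_zero])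
  rw [hint, integral_indicator measurableSet_Ici, integral_Ici_eq_integral_Ioi,
    integral_const_mul, integral_exp_mul_complex_Ioi hre]
  simp
  field_simp
  ring

lemma mgf_id_expMeasure {r : ℝ} (hr : 0 < r) {t : ℝ} (ht : t < r) :
    mgf id (expMeasure r) t = r / (r - t) := by
  have := complexMGF_id_expMeasure hr (z := t) (by simpa using ht)
  rw [complexMGF_ofReal] at this
  exact_mod_cast this

/-! ### The functional equation and its differential equation -/

lemma mul_secondDeriv_eq_of_mixture_factorizes {p : ℝ} (hp : p ∈ Set.Ioo (0 : ℝ) 1)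
    {φ φ' φ'' f g : ℝ → ℝ} (hφ : ∀ s, 0 < s → HasDerivAt φ (φ' s) s)
    (hφ' : ∀ s, 0 < s → HasDerivAt φ' (φ'' s) s) (hpos : ∀ s, 0 < s → 0 < φ s)
    (hf : ∀ s, 0 < s → DifferentiableAt ℝ f s) (hg : ∀ s, 0 < s → DifferentiableAt ℝ g s)
    (h : ∀ s t, 0 < s → 0 < t →
      φ ((1 - p) * s + p * t) * (p * φ s + (1 - p) * φ t) = f s * g t)
    {s : ℝ} (hs : 0 < s) : φ s * φ'' s = 2 * φ' s ^ 2 := by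
  have hp0 := hp.1
  have hq0 : 0 < 1 - p := sub_pos.2 hp.2
  have hd {F G : ℝ → ℝ} {F' G' x : ℝ} (hx : 0 < x) (hF : HasDerivAt F F' x)
      (hG : HasDerivAt G G' x) (e : ∀ y, 0 < y → F y = G y) : F' = G' := by
    refine hF.unique (hG.congr_of_eventuallyEq ?_)
    filter_upwards [Ioi_mem_nhds hx] with y hy using e y hy
  have l1 (s t : ℝ) : HasDerivAt (fun y => (1 - p) * y + p * t) (1 - p) s := by
    simpa using ((hasDerivAt_id s).const_mul (1 - p)).add_const (p * t)
  have l2 (s t : ℝ) : HasDerivAt (fun y => (1 - p) * s + p * y) p t := by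
    simpa using ((hasDerivAt_id t).const_mul p).const_add ((1 - p) * s)
  have hcomb {s t : ℝ} (hs : 0 < s) (ht : 0 < t) : 0 < (1 - p) * s + p * t := by positivity
  -- `e1`, `e2`, `e12` are the `s`-, `t`- and mixed derivatives of the equation.
  have e1 (s t : ℝ) (hs : 0 < s) (ht : 0 < t) :
      φ' ((1 - p) * s + p * t) * (1 - p) * (p * φ s + (1 - p) * φ t) +
        φ ((1 - p) * s + p * t) * (p * φ' s) = deriv f s * g t :=
    hd hs (((hφ _ (hcomb hs ht)).comp s (l1 s t)).mul
      (((hφ s hs).const_mul p).add_const ((1 - p) * φ t)))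
      ((hf s hs).hasDerivAt.mul_const (g t)) (fun y hy => h y t hy ht)
  have e2 (s t : ℝ) (hs : 0 < s) (ht : 0 < t) :
      φ' ((1 - p) * s + p * t) * p * (p * φ s + (1 - p) * φ t) +
        φ ((1 - p) * s + p * t) * ((1 - p) * φ' t) = f s * deriv g t :=
    hd ht (((hφ _ (hcomb hs ht)).comp t (l2 s t)).mul
      (((hφ t ht).const_mul (1 - p)).const_add (p * φ s)))
      ((hg t ht).hasDerivAt.const_mul (f s)) (fun y hy => h s y hs hy)
  have e12 (s t : ℝ) (hs : 0 < s) (ht : 0 < t) :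
      φ'' ((1 - p) * s + p * t) * p * (1 - p) * (p * φ s + (1 - p) * φ t) +
        φ' ((1 - p) * s + p * t) * (1 - p) * ((1 - p) * φ' t) +
        φ' ((1 - p) * s + p * t) * p * (p * φ' s) = deriv f s * deriv g t :=
    hd ht (((((hφ' _ (hcomb hs ht)).comp t (l2 s t)).mul_const (1 - p)).mul
      (((hφ t ht).const_mul (1 - p)).const_add (p * φ s))).add
      (((hφ _ (hcomb hs ht)).comp t (l2 s t)).mul_const (p * φ' s)))
      ((hg t ht).hasDerivAt.const_mul (deriv f s)) (fun y hy => e1 s y hs hy)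
  have k := h s s hs hs
  have k1 := e1 s s hs hs
  have k2 := e2 s s hs hs
  have k12 := e12 s s hs hs
  have hc : (1 - p) * s + p * s = s := by ring
  rw [hc] at k k1 k2 k12
  -- `F F_st = F_s F_t` at `t = s`, both sides being `f g f' g'`. The factor 2 in the conclusion
  -- arises from `1 - p^2 - (1-p)^2 = 2 p (1-p)`.
  have key : (φ s * (p * φ s + (1 - p) * φ s)) *
      (φ'' s * p * (1 - p) * (p * φ s + (1 - p) * φ s) + φ' s * (1 - p) * ((1 - p) * φ' s) +
        φ' s * p * (p * φ' s)) =
      (φ' s * (1 - p) * (p * φ s + (1 - p) * φ s) + φ s * (p * φ' s)) *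
        (φ' s * p * (p * φ s + (1 - p) * φ s) + φ s * ((1 - p) * φ' s)) := by
    rw [k, k1, k2, k12]; ring
  have hne : p * (1 - p) * φ s ^ 2 ≠ 0 := by have := hpos s hs; positivity
  apply mul_left_cancel₀ hne
  linear_combination key

/-- The hypothesis says that `(1/φ)' = -φ'/φ^2` has zero derivative. -/
lemma exists_eq_inv_affine {φ φ' φ'' : ℝ → ℝ} (hφ : ∀ s, 0 < s → HasDerivAt φ (φ' s) s)
    (hφ' : ∀ s, 0 < s → HasDerivAt φ' (φ'' s) s) (hpos : ∀ s, 0 < s → 0 < φ s)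
    (h : ∀ s, 0 < s → φ s * φ'' s = 2 * φ' s ^ 2) :
    ∃ α β : ℝ, ∀ s, 0 < s → (φ s)⁻¹ = α + β * s := by
  have d1 (s : ℝ) (hs : 0 < s) : HasDerivAt (fun y => (φ y)⁻¹) (-φ' s / φ s ^ 2) s :=
    (hφ s hs).inv (hpos s hs).ne'
  have d2 (s : ℝ) (hs : 0 < s) : HasDerivAt (fun y => -φ' y / φ y ^ 2) 0 s := by
    have hne := (hpos s hs).ne'
    refine (((hφ' s hs).neg).fun_div ((hφ s hs).fun_pow 2) (pow_ne_zero 2 hne)).congr_deriv ?_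
    rw [div_eq_zero_iff]
    left
    simp only [Pi.neg_apply]
    push_cast
    linear_combination -φ s * h s hs
  have const {F : ℝ → ℝ} (hF : ∀ s, 0 < s → HasDerivAt F 0 s) (s : ℝ) (hs : 0 < s) :
      F s = F 1 :=
    isOpen_Ioi.is_const_of_deriv_eq_zero isPreconnected_Ioi
      (fun x hx => (hF x hx).differentiableAt.differentiableWithinAt)
      (fun x hx => (hF x hx).deriv) hs (Set.mem_Ioi.2 one_pos)
  set β := -φ' 1 / φ 1 ^ 2 with hβ
  have d3 (s : ℝ) (hs : 0 < s) : HasDerivAt (fun y => (φ y)⁻¹ - β * y) 0 s := by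
    refine ((d1 s hs).fun_sub ((hasDerivAt_id s).const_mul β)).congr_deriv ?_
    rw [const d2 s hs, ← hβ, mul_one, sub_self]
  refine ⟨(φ 1)⁻¹ - β * 1, β, fun s hs => ?_⟩
  linarith [const d3 s hs]

/-! ### Linear forms with a Bernoulli coefficient -/

section BernoulliMixture

variable {Ω : Type*} [MeasurableSpace Ω] {P : Measure Ω} [IsProbabilityMeasure P] {p : ℝ}
  {X Y ε : Ω → ℝ}

lemma ae_eq_one_or_eq_zero_of_bernoulli (hp : p ∈ Set.Ioo (0 : ℝ) 1) (hε : Measurable ε)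
    (hε1 : P {ω | ε ω = 1} = ENNReal.ofReal p)
    (hε0 : P {ω | ε ω = 0} = ENNReal.ofReal (1 - p)) : ∀ᵐ ω ∂P, ε ω = 1 ∨ ε ω = 0 := by
  have m1 : MeasurableSet {ω | ε ω = 1} := hε (measurableSet_singleton 1)
  have m0 : MeasurableSet {ω | ε ω = 0} := hε (measurableSet_singleton 0)
  have hu : P ({ω | ε ω = 1} ∪ {ω | ε ω = 0}) = 1 := by
    rw [measure_union (Set.disjoint_left.2 fun ω h1 h0 => ?_) m0, hε1, hε0,
      ← ENNReal.ofReal_add hp.1.le (sub_pos.2 hp.2).le]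
    · simp
    · exact one_ne_zero ((show ε ω = 1 from h1).symm.trans h0)
  exact (prob_compl_eq_zero_iff (m1.union m0)).2 hu

lemma integral_ofReal_of_bernoulli (hp : p ∈ Set.Ioo (0 : ℝ) 1) (hε : Measurable ε)
    (hε1 : P {ω | ε ω = 1} = ENNReal.ofReal p)
    (hε0 : P {ω | ε ω = 0} = ENNReal.ofReal (1 - p)) : ∫ ω, (ε ω : ℂ) ∂P = p := by
  have m1 : MeasurableSet {ω | ε ω = 1} := hε (measurableSet_singleton 1)
  rw [integral_complex_ofReal]
  congr 1
  have : ε =ᵐ[P] {ω | ε ω = 1}.indicator 1 := by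
    filter_upwards [ae_eq_one_or_eq_zero_of_bernoulli hp hε hε1 hε0] with ω h
    rcases h with h | h <;> simp [Set.indicator, h]
  rw [integral_congr_ae this, integral_indicator_one m1, measureReal_def, hε1,
    ENNReal.toReal_ofReal hp.1.le]

/-- The joint transform of the two linear forms with random coefficients. -/
lemma integral_cexp_randomCoeff_forms (hp : p ∈ Set.Ioo (0 : ℝ) 1) {a b : ℝ} (ha : 0 < a)
    (hb : 0 < b) (hX : Measurable X) (hY : Measurable Y) (hε : Measurable ε)
    (hε1 : P {ω | ε ω = 1} = ENNReal.ofReal p)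
    (hε0 : P {ω | ε ω = 0} = ENNReal.ofReal (1 - p))
    (hXY : IdentDistrib X Y P P) (hindep : iIndepFun ![X, Y, ε] P)
    (hXpos : ∀ᵐ ω ∂P, 0 ≤ X ω) (hYpos : ∀ᵐ ω ∂P, 0 ≤ Y ω)
    {u v : ℂ} (hu : u.re ≤ 0) (hv : v.re ≤ 0) :
    ∫ ω, Complex.exp (u * ((1 - p) * a * X ω + ε ω * a * Y ω : ℝ) +
        v * (p * b * X ω + (1 - ε ω) * b * Y ω : ℝ)) ∂P =
      complexMGF X P ((1 - p) * a * u + p * b * v) *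
        (p * complexMGF X P (a * u) + (1 - p) * complexMGF X P (b * v)) := by
  have hp0 := hp.1
  have hq0 : 0 < 1 - p := sub_pos.2 hp.2
  have hmeas : ∀ i, Measurable (![X, Y, ε] i) := by
    intro i; fin_cases i <;> assumption
  have iXY : IndepFun X Y P := hindep.indepFun (i := 0) (j := 1) (by decide)
  have iXYε : IndepFun (fun ω => (X ω, Y ω)) ε P :=
    hindep.indepFun_prodMk hmeas 0 1 2 (by decide) (by decide)
  have h01 := ae_eq_one_or_eq_zero_of_bernoulli hp hε hε1 hε0
  set c : ℂ := (1 - p) * a * u + p * b * v with hc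
  have re_mul {k : ℝ} {w : ℂ} (hk : 0 < k) (hw : w.re ≤ 0) : ((k : ℂ) * w).re ≤ 0 := by
    simpa using mul_nonpos_of_nonneg_of_nonpos hk.le hw
  have hcre : c.re ≤ 0 := by
    have h1 := re_mul (mul_pos hq0 ha) hu
    have h2 := re_mul (mul_pos hp0 hb) hv
    have : c = (((1 - p) * a : ℝ) : ℂ) * u + ((p * b : ℝ) : ℂ) * v := by push_cast; rfl
    rw [this, Complex.add_re]
    exact add_nonpos h1 h2
  have prod_eq (w : ℂ) : ∫ ω, Complex.exp (c * X ω) * Complex.exp (w * Y ω) ∂P =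
      complexMGF X P c * complexMGF X P w := by
    rw [complexMGF_congr_identDistrib hXY]
    nth_rw 1 [← complexMGF_congr_identDistrib hXY]
    exact iXY.integral_fun_comp_mul_comp (f := fun x : ℝ => Complex.exp (c * x))
      (g := fun x : ℝ => Complex.exp (w * x)) hX.aemeasurable hY.aemeasurable (by fun_prop)
      (by fun_prop)
  -- Used with the weights `ε` and `1 - ε`, which select the two branches; they need only be bounded
  -- at 0 and 1.
  have term (w : ℂ) (hw : w.re ≤ 0) (G : ℝ → ℂ) (hG : Measurable G)
      (hG1 : ∀ x, x = 1 ∨ x = 0 → ‖G x‖ ≤ 1) :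
      Integrable (fun ω => Complex.exp (c * X ω) * Complex.exp (w * Y ω) * G (ε ω)) P ∧
      ∫ ω, Complex.exp (c * X ω) * Complex.exp (w * Y ω) * G (ε ω) ∂P =
        complexMGF X P c * complexMGF X P w * ∫ ω, G (ε ω) ∂P := by
    refine ⟨Integrable.of_bound (by fun_prop) 1 ?_, ?_⟩
    · filter_upwards [hXpos, hYpos, h01] with ω hx hy he
      rw [norm_mul, norm_mul]
      refine mul_le_one₀ (mul_le_one₀ ?_ (norm_nonneg _) ?_) (norm_nonneg _) (hG1 _ he)
      · simpa [Complex.norm_exp] using mul_nonpos_of_nonpos_of_nonneg hcre hx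
      · simpa [Complex.norm_exp] using mul_nonpos_of_nonpos_of_nonneg hw hy
    · rw [← prod_eq w]
      exact iXYε.integral_fun_comp_mul_comp
        (f := fun x : ℝ × ℝ => Complex.exp (c * x.1) * Complex.exp (w * x.2)) (g := G)
        (hX.prodMk hY).aemeasurable hε.aemeasurable (by fun_prop) hG.aestronglyMeasurable
  obtain ⟨int1, eq1⟩ := term (a * u) (re_mul ha hu) (fun x => (x : ℂ)) (by fun_prop)
    (by rintro x (rfl | rfl) <;> simp)
  obtain ⟨int2, eq2⟩ := term (b * v) (re_mul hb hv) (fun x => 1 - (x : ℂ)) (by fun_prop)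
    (by rintro x (rfl | rfl) <;> simp)
  have hεint : Integrable (fun ω => (ε ω : ℂ)) P := by
    refine Integrable.of_bound (by fun_prop) 1 ?_
    filter_upwards [h01] with ω h
    rcases h with h | h <;> simp [h]
  have e1 := integral_ofReal_of_bernoulli hp hε hε1 hε0
  have e2 : ∫ ω, (1 - (ε ω : ℂ)) ∂P = 1 - p := by
    rw [integral_sub (integrable_const _) hεint, e1]; simp
  calc _ = ∫ ω, (Complex.exp (c * X ω) * Complex.exp (a * u * Y ω) * (ε ω : ℂ) +
        Complex.exp (c * X ω) * Complex.exp (b * v * Y ω) * (1 - (ε ω : ℂ))) ∂P := by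
        refine integral_congr_ae ?_
        filter_upwards [h01] with ω h
        rcases h with h | h <;>
        · simp only [h]
          push_cast
          simp only [mul_one, mul_zero, sub_self, sub_zero, add_zero, zero_add, zero_mul]
          rw [← Complex.exp_add, hc]
          ring_nf
    _ = _ := by
        rw [integral_add int1 int2, eq1, eq2, e1, e2]
        ring

lemma indepFun_randomCoeff_forms_of_expMeasure (hp : p ∈ Set.Ioo (0 : ℝ) 1) {a b : ℝ}
    (ha : 0 < a) (hb : 0 < b) (hX : Measurable X) (hY : Measurable Y) (hε : Measurable ε)
    (hε1 : P {ω | ε ω = 1} = ENNReal.ofReal p)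
    (hε0 : P {ω | ε ω = 0} = ENNReal.ofReal (1 - p))
    (hXY : IdentDistrib X Y P P) (hindep : iIndepFun ![X, Y, ε] P)
    (hXpos : ∀ᵐ ω ∂P, 0 ≤ X ω) (hYpos : ∀ᵐ ω ∂P, 0 ≤ Y ω) {r : ℝ} (hr : 0 < r)
    (hXr : P.map X = expMeasure r) :
    IndepFun (fun ω => (1 - p) * a * X ω + ε ω * a * Y ω)
        (fun ω => p * b * X ω + (1 - ε ω) * b * Y ω) P := by
  have hM (z : ℂ) (hz : z.re ≤ 0) : complexMGF X P z = r / (r - z) := by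
    rw [← complexMGF_id_map hX.aemeasurable, hXr]
    exact complexMGF_id_expMeasure hr (hz.trans_lt hr)
  have hM0 : complexMGF X P 0 = 1 := by simp [complexMGF]
  rw [indepFun_iff_charFun_prod (by fun_prop) (by fun_prop)]
  intro t
  have hre (k : ℝ) : ((k : ℂ) * Complex.I).re ≤ 0 := by simp
  have J {u v : ℂ} (hu : u.re ≤ 0) (hv : v.re ≤ 0) :=
    integral_cexp_randomCoeff_forms hp ha hb hX hY hε hε1 hε0 hXY hindep hXpos hYpos hu hv
  have K := J (hre t.fst) (hre t.snd)
  -- Setting one variable to zero gives the marginal transforms.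
  have K1 := J (hre t.fst) (v := 0) (by simp)
  have K2 := J (u := 0) (by simp) (hre t.snd)
  simp only [zero_mul, mul_zero, add_zero, zero_add] at K1 K2
  have e : charFun (P.map (fun ω => WithLp.toLp 2 ((1 - p) * a * X ω + ε ω * a * Y ω,
      p * b * X ω + (1 - ε ω) * b * Y ω))) t =
      ∫ ω, Complex.exp (t.fst * Complex.I * ((1 - p) * a * X ω + ε ω * a * Y ω : ℝ) +
        t.snd * Complex.I * (p * b * X ω + (1 - ε ω) * b * Y ω : ℝ)) ∂P := by
    rw [charFun_apply, integral_map (by fun_prop) (by fun_prop)]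
    congr with ω
    rw [WithLp.prod_inner_apply]
    simp
    ring_nf
  have e' {L : Ω → ℝ} (hL : Measurable L) (k : ℝ) : charFun (P.map L) k =
      ∫ ω, Complex.exp (k * Complex.I * L ω) ∂P := by
    rw [charFun_apply_real, integral_map (by fun_prop) (by fun_prop)]
    congr with ω
    ring_nf
  rw [e, K, e' (by fun_prop), e' (by fun_prop), WithLp.ofLp_fst, WithLp.ofLp_snd, K1, K2, hM0]
  have ne {w : ℂ} (hw : w.re = 0) : (r : ℂ) - w ≠ 0 := fun h0 => by
    have := congrArg Complex.re h0
    simp [hw] at this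
    exact hr.ne' this
  generalize hu : (t.fst : ℂ) * Complex.I = u
  generalize hv : (t.snd : ℂ) * Complex.I = v
  have hu0 : u.re = 0 := by simp [← hu]
  have hv0 : v.re = 0 := by simp [← hv]
  have r1 : ((1 - (p : ℂ)) * a * u + p * b * v).re = 0 := by simp [hu0, hv0]
  have r2 : ((1 - (p : ℂ)) * a * u).re = 0 := by simp [hu0]
  have r3 : ((p : ℂ) * b * v).re = 0 := by simp [hv0]
  have r4 : ((a : ℂ) * u).re = 0 := by simp [hu0]
  have r5 : ((b : ℂ) * v).re = 0 := by simp [hv0]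
  rw [hM _ r1.le, hM _ r2.le, hM _ r3.le, hM _ r4.le, hM _ r5.le]
  have n1 := ne r1
  have n2 := ne r2
  have n3 := ne r3
  have n4 := ne r4
  have n5 := ne r5
  -- Both sides equal `r / (r - a u) * (r / (r - b v))`.
  field_simp
  ring

lemma exists_map_eq_expMeasure_of_indepFun_randomCoeff_forms (hp : p ∈ Set.Ioo (0 : ℝ) 1)
    {a b : ℝ} (ha : 0 < a) (hb : 0 < b) (hX : Measurable X) (hY : Measurable Y)
    (hε : Measurable ε) (hε1 : P {ω | ε ω = 1} = ENNReal.ofReal p)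
    (hε0 : P {ω | ε ω = 0} = ENNReal.ofReal (1 - p))
    (hXY : IdentDistrib X Y P P) (hindep : iIndepFun ![X, Y, ε] P)
    (hXpos : ∀ᵐ ω ∂P, 0 < X ω) (hYpos : ∀ᵐ ω ∂P, 0 < Y ω)
    (h : IndepFun (fun ω => (1 - p) * a * X ω + ε ω * a * Y ω)
        (fun ω => p * b * X ω + (1 - ε ω) * b * Y ω) P) :
    ∃ r : ℝ, 0 < r ∧ P.map X = expMeasure r := by
  have hX0 : ∀ᵐ ω ∂P, 0 ≤ X ω := hXpos.mono fun ω h => h.le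
  have hY0 : ∀ᵐ ω ∂P, 0 ≤ Y ω := hYpos.mono fun ω h => h.le
  have J {u v : ℂ} (hu : u.re ≤ 0) (hv : v.re ≤ 0) :=
    integral_cexp_randomCoeff_forms hp ha hb hX hY hε hε1 hε0 hXY hindep hX0 hY0 hu hv
  let φ : ℝ → ℝ := fun s => mgf X P (-s)
  have hM0 : complexMGF X P 0 = 1 := by simp [complexMGF]
  have hp0 := hp.1
  have hq0 : 0 < 1 - p := sub_pos.2 hp.2
  have hfun (s t : ℝ) (hs : 0 < s) (ht : 0 < t) :
      φ ((1 - p) * s + p * t) * (p * φ s + (1 - p) * φ t) =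
        (φ ((1 - p) * s) * (p * φ s + (1 - p))) * (φ (p * t) * (p + (1 - p) * φ t)) := by
    -- The arguments `-s/a` and `-t/b` scale `a` and `b` away.
    have hu : ((-(s / a) : ℝ) : ℂ).re ≤ 0 := by simp; positivity
    have hv : ((-(t / b) : ℝ) : ℂ).re ≤ 0 := by simp; positivity
    have K := J hu hv
    have K1 := J hu (v := 0) (by simp)
    have K2 := J (u := 0) (by simp) hv
    have I := h.integral_fun_comp_mul_comp
      (f := fun x : ℝ => Complex.exp ((-(s / a) : ℝ) * x))
      (g := fun x : ℝ => Complex.exp ((-(t / b) : ℝ) * x)) (by fun_prop) (by fun_prop)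
      (by fun_prop) (by fun_prop)
    simp only [zero_mul, mul_zero, add_zero, zero_add] at K1 K2
    simp_rw [← Complex.exp_add] at I
    rw [K, K1, K2, hM0] at I
    have a1 : (1 - (p : ℂ)) * a * (-(s / a) : ℝ) + p * b * (-(t / b) : ℝ) =
        ((-((1 - p) * s + p * t) : ℝ) : ℂ) := by
      have : (a : ℂ) ≠ 0 := by exact_mod_cast ha.ne'
      have : (b : ℂ) ≠ 0 := by exact_mod_cast hb.ne'
      push_cast; field_simp; ring
    have a2 : (1 - (p : ℂ)) * a * (-(s / a) : ℝ) = ((-((1 - p) * s) : ℝ) : ℂ) := by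
      have : (a : ℂ) ≠ 0 := by exact_mod_cast ha.ne'
      push_cast; field_simp
    have a3 : (p : ℂ) * b * (-(t / b) : ℝ) = ((-(p * t) : ℝ) : ℂ) := by
      have : (b : ℂ) ≠ 0 := by exact_mod_cast hb.ne'
      push_cast; field_simp
    have a4 : (a : ℂ) * (-(s / a) : ℝ) = ((-s : ℝ) : ℂ) := by
      have : (a : ℂ) ≠ 0 := by exact_mod_cast ha.ne'
      push_cast; field_simp
    have a5 : (b : ℂ) * (-(t / b) : ℝ) = ((-t : ℝ) : ℂ) := by
      have : (b : ℂ) ≠ 0 := by exact_mod_cast hb.ne'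
      push_cast; field_simp
    rw [a1, a2, a3, a4, a5] at I
    simp only [complexMGF_ofReal] at I
    have I' := congrArg Complex.re I
    norm_cast at I'
    simp only [φ]
    linear_combination I'
  have hInt := Iio_subset_interior_integrableExpSet_of_nonneg hX.aemeasurable hX0
  have han (s : ℝ) (hs : 0 < s) : AnalyticAt ℝ φ s := by
    refine (analyticAt_mgf (hInt ?_)).comp analyticAt_id.neg
    simpa using hs
  have hd (s : ℝ) (hs : 0 < s) := (han s hs).differentiableAt
  have hpos (s : ℝ) (hs : 0 < s) : 0 < φ s :=
    mgf_pos (integrable_of_mem_integrableExpSet (interior_subset (hInt (neg_lt_zero.2 hs))))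
  have hd1 (s : ℝ) (hs : 0 < s) := (hd s hs).hasDerivAt
  have hd2 (s : ℝ) (hs : 0 < s) := (han s hs).deriv.differentiableAt.hasDerivAt
  have hcm {k s : ℝ} (hk : 0 < k) (hs : 0 < s) : DifferentiableAt ℝ (fun x => φ (k * x)) s :=
    (hd _ (mul_pos hk hs)).comp s (by fun_prop)
  obtain ⟨α, β, hαβ⟩ := exists_eq_inv_affine hd1 hd2 hpos fun s hs =>
    mul_secondDeriv_eq_of_mixture_factorizes hp hd1 hd2 hpos
      (fun s hs => (hcm hq0 hs).mul (((hd s hs).const_mul p).add_const _))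
      (fun s hs => (hcm hp0 hs).mul (((hd s hs).const_mul (1 - p)).const_add _)) hfun hs
  -- Zero may lie on the boundary of the domain of analyticity, so the limit comes from continuity
  -- on the closed half-plane.
  have hlim : Filter.Tendsto φ (nhdsWithin 0 (Set.Ioi 0)) (nhds 1) := by
    have hc := continuousOn_complexMGF_of_nonneg hX.aemeasurable hX0 0 (by simp)
    have hg : Filter.Tendsto (fun s : ℝ => ((-s : ℝ) : ℂ)) (nhdsWithin 0 (Set.Ioi 0))
        (nhdsWithin 0 {z : ℂ | z.re ≤ 0}) := by
      refine tendsto_nhdsWithin_iff.2 ⟨?_, ?_⟩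
      · have : Continuous fun s : ℝ => ((-s : ℝ) : ℂ) := by fun_prop
        simpa using (this.tendsto 0).mono_left nhdsWithin_le_nhds
      · filter_upwards [self_mem_nhdsWithin] with s (hs : 0 < s)
        simpa using hs.le
    have := (Complex.continuous_re.tendsto _).comp (hc.tendsto.comp hg)
    simpa only [Function.comp_def, complexMGF_ofReal, hM0, Complex.ofReal_re, Complex.one_re]
      using this
  have hα : α = 1 := by
    have h1 : Filter.Tendsto (fun s => α + β * s) (nhdsWithin 0 (Set.Ioi 0)) (nhds α) := by
      have : Continuous fun s : ℝ => α + β * s := by fun_prop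
      simpa using (this.tendsto 0).mono_left nhdsWithin_le_nhds
    have h2 := hlim.inv₀ one_ne_zero
    rw [inv_one] at h2
    refine tendsto_nhds_unique h1 (h2.congr' ?_)
    filter_upwards [self_mem_nhdsWithin] with s hs using hαβ s hs
  subst hα
  -- Strict positivity of `X` enters here: it forces `φ 1 < 1`, while `1/φ 1 = 1 + β`.
  have hβ : 0 < β := by
    have hlt : φ 1 < 1 := by
      have hi : Integrable (fun ω => Real.exp (-1 * X ω)) P :=
        integrable_of_mem_integrableExpSet
          (interior_subset (hInt (Set.mem_Iio.2 (neg_lt_zero.2 one_pos))))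
      have : 0 < ∫ ω, (1 - Real.exp (-1 * X ω)) ∂P := by
        have hlt' : ∀ᵐ ω ∂P, 0 < 1 - Real.exp (-1 * X ω) := by
          filter_upwards [hXpos] with ω hω
          rw [sub_pos, Real.exp_lt_one_iff]
          linarith
        refine (integral_pos_iff_support_of_nonneg_ae (hlt'.mono fun ω h => h.le)
          ((integrable_const _).sub hi)).2 ?_
        have : P (Function.support fun ω => 1 - Real.exp (-1 * X ω)) = 1 :=
          (measure_congr (Filter.eventuallyEq_univ.2 (hlt'.mono fun ω h => h.ne'))).trans
            measure_univ
        rw [this]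
        exact one_pos
      rw [integral_sub (integrable_const _) hi] at this
      simpa [φ, mgf] using this
    have := (one_lt_inv₀ (hpos 1 one_pos)).2 hlt
    rw [hαβ 1 one_pos] at this
    linarith
  -- The rate is read off from `1 / (1 + β s) = β⁻¹ / (β⁻¹ + s)`.
  refine ⟨β⁻¹, inv_pos.2 hβ, ?_⟩
  have := isProbabilityMeasure_expMeasure (inv_pos.2 hβ)
  have := Measure.isProbabilityMeasure_map (μ := P) hX.aemeasurable
  refine ext_of_mgf_eqOn_Iio ?_ (ae_nonneg_expMeasure _) fun t (ht : t < 0) => ?_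
  · exact (ae_map_iff hX.aemeasurable measurableSet_Ici).2 hX0
  · rw [mgf_id_expMeasure (inv_pos.2 hβ) (ht.trans (inv_pos.2 hβ)), mgf_id_map hX.aemeasurable]
    have := hαβ (-t) (neg_pos.2 ht)
    simp only [φ, neg_neg] at this
    rw [← inv_inv (mgf X P t), this]
    have : 0 < 1 + β * -t := by nlinarith
    have : 0 < β⁻¹ - t := by have := inv_pos.2 hβ; linarith
    field_simp
    ring

end BernoulliMixture

theorem theorem1 {Ω : Type*} [MeasurableSpace Ω] (P : Measure Ω) [IsProbabilityMeasure P]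
    (p : ℝ) (hp : p ∈ Set.Ioo (0 : ℝ) 1) (a b : ℝ) (ha : 0 < a) (hb : 0 < b)
    (X Y ε : Ω → ℝ) (hX : Measurable X) (hY : Measurable Y) (hε : Measurable ε)
    (hε1 : P {ω | ε ω = 1} = ENNReal.ofReal p)
    (hε0 : P {ω | ε ω = 0} = ENNReal.ofReal (1 - p))
    (hXY : IdentDistrib X Y P P)
    (hindep : iIndepFun ![X, Y, ε] P)
    (hXpos : ∀ᵐ ω ∂P, 0 < X ω) (hYpos : ∀ᵐ ω ∂P, 0 < Y ω) :
    IndepFun (fun ω => (1 - p) * a * X ω + ε ω * a * Y ω)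
        (fun ω => p * b * X ω + (1 - ε ω) * b * Y ω) P ↔
      ∃ r : ℝ, 0 < r ∧ P.map X = expMeasure r ∧ P.map Y = expMeasure r := by
  constructor
  · intro h
    obtain ⟨r, hr, hXr⟩ := exists_map_eq_expMeasure_of_indepFun_randomCoeff_forms hp ha hb hX hY
      hε hε1 hε0 hXY hindep hXpos hYpos h
    exact ⟨r, hr, hXr, hXY.map_eq ▸ hXr⟩
  · rintro ⟨r, hr, hXr, -⟩
    exact indepFun_randomCoeff_forms_of_expMeasure hp ha hb hX hY hε hε1 hε0 hXY hindep
      (hXpos.mono fun ω h => h.le) (hYpos.mono fun ω h => h.le) hr hXr
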